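/- Let $n\ge 2$ agents have a state vector $x=(x_1,\dots,x_n)\sim N(\mu\mathbf 1_n,\sigma^2 I_n)$, $\mu\in\mathbb R$, $\sigma^2>0$, and let $\beta\ge 0$. For adjacency matrices $(g_{ij})$ (incentive graph $G$) and $(\tilde g_{ij})$ (synergy graph $\widetilde G$) on the agents, agent $i$ has payoff $$u_i(a,x)=-(a_i-x_i)^2-\beta\sum_{j=1}^n g_{ij}(a_i-a_j)^2$$ and the principal has payoff $$v(a,x)=-\sum_{i=1}^n(a_i-x_i)^2-\beta\sum_{i=1}^n\sum_{j=1}^n\tilde g_{ij}(a_i-a_j)^2 .$$ The principal commits to a public signal, that is, a Markov kernel $\varphi$ from $\mathbb R^n$ to an arbitrary measurable space $M$. After each realization $m\in M$ the agents, who share the posterior given $m$, choose actions $a_i\in\mathbb R$ that form a Nash equilibrium for the expected payoffs $\mathbb E[u_i(a,x)\mid m]$. A signal is optimal if, with equilibrium play, it maximizes $\mathbb E[v(a,x)]$ over all public signals. A signal informs the agents of a variable $y$ if $\mathbb E[y\mid m]=y$ almost surely. Suppose that $\widetilde G=K_n$ is the complete graph and that $G$ is the star whose core is the agent $c\in\{1,\dots,n\}$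 (for instance $c=1$): $g_{cj}=g_{jc}=1$ for $j\ne c$, and all other entries are $0$. Let $\bar x_{-c}=\frac1{n-1}\sum_{j\ne c}x_j$. (i) If $\beta>\frac{1}{2(n-1)}$, then the signal that discloses exactly $(x_c,\bar x_{-c})$ is optimal. Moreover, every optimal signal informs the agents of $x_c$ and of $\bar x_{-c}$, and satisfies $\mathbb E[x_j\mid m]=\bar x_{-c}$ almost surely for every $j\neq c$. (ii) If $\beta\le\frac{1}{2(n-1)}$, then full revelation (the signal $m=x$) is optimal. -/

import Mathlib

open MeasureTheory ProbabilityTheory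
open scoped NNReal ENNReal ProbabilityTheory

universe u v

namespace PublicSignal

noncomputable section

/-- A vector with one real entry per agent: a state vector `x` or an action profile `a`. -/
abbrev Profile (n : ℕ) : Type := Fin n → ℝ

/-- Payoff of agent `i`:
`u_i(a, x) = -(a_i - x_i)² - β ∑_j g_{ij} (a_i - a_j)²`. -/
def agentPayoff {n : ℕ} (β : ℝ) (g : Matrix (Fin n) (Fin n) ℝ) (i : Fin n)
    (a x : Profile n) : ℝ :=
  -(a i - x i) ^ 2 - β * ∑ j, g i j * (a i - a j) ^ 2

/-- Payoff of the principal: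
`v(a, x) = -∑_i (a_i - x_i)² - β ∑_i ∑_j g̃_{ij} (a_i - a_j)²`. -/
def principalPayoff {n : ℕ} (β : ℝ) (gt : Matrix (Fin n) (Fin n) ℝ) (a x : Profile n) : ℝ :=
  -(∑ i, (a i - x i) ^ 2) - β * ∑ i, ∑ j, gt i j * (a i - a j) ^ 2

/-- The prior `N(μ 1, σ² I)`: the local states are i.i.d. normal with mean `μ` and
variance `s = σ²`. -/
abbrev prior (n : ℕ) (μ : ℝ) (s : ℝ≥0) : Measure (Profile n) :=
  Measure.pi fun _ : Fin n => gaussianReal μ s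

/-- `a` is a Nash equilibrium of the game played when `ν` is the agents' common belief about
the state: no agent gains in expectation from a unilateral deviation. -/
def IsNash {n : ℕ} (β : ℝ) (g : Matrix (Fin n) (Fin n) ℝ) (ν : Measure (Profile n))
    (a : Profile n) : Prop :=
  ∀ (i : Fin n) (b : ℝ),
    ∫ x, agentPayoff β g i (Function.update a i b) x ∂ν ≤ ∫ x, agentPayoff β g i a x ∂ν

/-- A public signal is a Markov kernel `φ` from states to an arbitrary measurable space `M` of
realizations. A strategy profile `a : M → ℝⁿ` is an equilibrium if, after almost every
realization `m`, the profile `a m` is a Nash equilibrium under the common posterior `(φ†P) m`.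
(Under a square-integrable prior almost every posterior is square integrable, so all expected
payoffs that occur here are finite.) -/
def IsEquilibrium {n : ℕ} {M : Type u} [MeasurableSpace M] (β : ℝ)
    (g : Matrix (Fin n) (Fin n) ℝ) (P : Measure (Profile n)) [IsFiniteMeasure P]
    (φ : Kernel (Profile n) M) [IsMarkovKernel φ] (a : M → Profile n) : Prop :=
  Measurable a ∧ ∀ᵐ m ∂(φ ∘ₘ P), IsNash β g ((φ†P) m) (a m)

/-- Ex ante expected payoff of the principal under signal `φ` and strategy profile `a`. -/
def principalValue {n : ℕ} {M : Type u} [MeasurableSpace M] (β : ℝ)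
    (gt : Matrix (Fin n) (Fin n) ℝ) (P : Measure (Profile n))
    (φ : Kernel (Profile n) M) (a : M → Profile n) : ℝ :=
  ∫ p, principalPayoff β gt (a p.2) p.1 ∂(P ⊗ₘ φ)

/-- The signal `φ` is optimal: with equilibrium play, it gives the principal an expected payoff
at least as high as any other public signal (with realizations in any measurable space) with
any equilibrium of it. (Equilibria are unique up to null sets.) -/
def IsOptimal {n : ℕ} {M : Type u} [MeasurableSpace M] (β : ℝ)
    (g gt : Matrix (Fin n) (Fin n) ℝ) (P : Measure (Profile n)) [IsFiniteMeasure P]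
    (φ : Kernel (Profile n) M) [IsMarkovKernel φ] : Prop :=
  ∃ a : M → Profile n, IsEquilibrium β g P φ a ∧
    ∀ (M' : Type v) [MeasurableSpace M'] (φ' : Kernel (Profile n) M') [IsMarkovKernel φ']
      (a' : M' → Profile n), IsEquilibrium β g P φ' a' →
        principalValue β gt P φ' a' ≤ principalValue β gt P φ a

/-- The conditional expectation of the variable `y` given the realization `m` of `φ`. -/
def posteriorMean {n : ℕ} {M : Type u} [MeasurableSpace M] (P : Measure (Profile n))
    [IsFiniteMeasure P] (φ : Kernel (Profile n) M) [IsMarkovKernel φ] (y : Profile n → ℝ)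
    (m : M) : ℝ :=
  ∫ x, y x ∂((φ†P) m)

/-- The signal `φ` informs the agents of `y`: `E[y | m] = y` almost surely, under the joint law
of the state and the realization. -/
def Informs {n : ℕ} {M : Type u} [MeasurableSpace M] (P : Measure (Profile n))
    [IsFiniteMeasure P] (φ : Kernel (Profile n) M) [IsMarkovKernel φ] (y : Profile n → ℝ) :
    Prop :=
  ∀ᵐ p ∂(P ⊗ₘ φ), posteriorMean P φ y p.2 = y p.1

/-- The average state of the agents other than `c`. -/
def othersAverage {n : ℕ} (c : Fin n) (x : Profile n) : ℝ :=
  (∑ j ∈ Finset.univ.erase c, x j) / ((n : ℝ) - 1)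

theorem measurable_othersAverage {n : ℕ} (c : Fin n) :
    Measurable (othersAverage c : Profile n → ℝ) := by
  unfold othersAverage
  fun_prop

/-- The noiseless signal that discloses exactly `x_c` and the average state of the others. -/
abbrev coreAndAverageSignal {n : ℕ} (c : Fin n) : Kernel (Profile n) (ℝ × ℝ) :=
  Kernel.deterministic (fun x => (x c, othersAverage c x))
    ((measurable_pi_apply c).prodMk (measurable_othersAverage c))

/-- Full revelation: the realization of the signal is the state itself. -/
abbrev fullRevelation (n : ℕ) : Kernel (Profile n) (Profile n) := Kernel.id

/-- The incentive graph: the star with core `c`. -/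
abbrev starMatrix {n : ℕ} (c : Fin n) : Matrix (Fin n) (Fin n) ℝ :=
  (SimpleGraph.starGraph c).adjMatrix ℝ

/-- The synergy graph: the complete graph. -/
abbrev completeMatrix (n : ℕ) : Matrix (Fin n) (Fin n) ℝ :=
  (⊤ : SimpleGraph (Fin n)).adjMatrix ℝ

end

end PublicSignal

namespace PublicSignal

/-! The equilibrium is linear in the vector `y` of posterior means. Forecast errors are orthogonal
to functions of the realization, so the principal's value is, up to a constant, E[Q(y)] + κ E[D(y)]
(`principalValue_eq`). Here Q is a quadratic form in `y_c` and the average of the other `y_j`, D is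
the dispersion of those `y_j` around their average, and κ = (1 - 2β(n-1))/(1+β)². The κ comes from
2/(1+β) - (1+2βn)/(1+β)², since a leaf plays `y_j`/(1+β) plus a term common to all leaves.

The form Q is positive definite for every β ≥ 0 (`coreForm_pos_def`). By a Pythagorean identity,
E[Q(y)] = E[Q(x)] - E[Q(x - y)] is largest exactly when `x_c` and the others' average are disclosed.
The same identity gives 0 ≤ E[D(y)] ≤ E[D(x)]. Hence only the sign of κ matters. If κ < 0 the best
value of E[D(y)] is 0; disclosing just `x_c` and the average attains it, because exchangeability of
the leaves equalizes their posterior means. If κ ≥ 0 full revelation attains both upper bounds.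
Uniqueness for κ < 0 is the equality case of the two bounds. -/

theorem ae_eq_zero_of_integral_sq_eq_zero {Ω : Type*} [MeasurableSpace Ω] {ρ : Measure Ω}
    {f : Ω → ℝ} (hf : MemLp f 2 ρ) (h : ∫ ω, f ω ^ 2 ∂ρ = 0) : ∀ᵐ ω ∂ρ, f ω = 0 := by
  rw [integral_eq_zero_iff_of_nonneg (fun ω => sq_nonneg (f ω)) hf.integrable_sq] at h
  filter_upwards [h] with ω hω
  simpa using hω

/-! ### Posterior means as orthogonal projections. -/

section Posterior

variable {n : ℕ} {M : Type u} [MeasurableSpace M] {P : Measure (Profile n)}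
  {φ : Kernel (Profile n) M} [IsMarkovKernel φ] {f : Profile n → ℝ}

theorem measurePreserving_fst_compProd [SFinite P] :
    MeasurePreserving Prod.fst (P ⊗ₘ φ) P :=
  ⟨measurable_fst, Measure.fst_compProd P φ⟩

theorem measurePreserving_snd_compProd [SFinite P] :
    MeasurePreserving Prod.snd (P ⊗ₘ φ) (φ ∘ₘ P) :=
  ⟨measurable_snd, Measure.snd_compProd P φ⟩

theorem integral_state_compProd [SFinite P] (hf : Measurable f) :
    ∫ p, f p.1 ∂(P ⊗ₘ φ) = ∫ x, f x ∂P := by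
  have h := integral_map (μ := P ⊗ₘ φ) (φ := Prod.fst) measurable_fst.aemeasurable
    (f := f) hf.aestronglyMeasurable
  rw [measurePreserving_fst_compProd.map_eq] at h
  exact h.symm

variable [IsProbabilityMeasure P]

theorem measurable_posteriorMean (hf : Measurable f) :
    Measurable (posteriorMean P φ f) :=
  (hf.stronglyMeasurable.integral_kernel (κ := φ†P)).measurable

/-- Bayes' rule: the joint law of state and realization, with its factors exchanged, is the marginal
of the realization composed with the posterior kernel. -/
theorem integrable_swap_compProd {F : Profile n × M → ℝ} (hF : Integrable F (P ⊗ₘ φ)) :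
    Integrable (fun q : M × Profile n => F q.swap) ((φ ∘ₘ P) ⊗ₘ (φ†P)) := by
  rw [compProd_posterior_eq_map_swap]
  have : MeasurableEmbedding (Prod.swap : Profile n × M → M × Profile n) :=
    MeasurableEquiv.prodComm.measurableEmbedding
  rw [this.integrable_map_iff]
  simpa [Function.comp_def] using hF

theorem integral_compProd_eq_posterior {F : Profile n × M → ℝ} (hF : Integrable F (P ⊗ₘ φ)) :
    ∫ p, F p ∂(P ⊗ₘ φ) = ∫ m, ∫ x, F (x, m) ∂((φ†P) m) ∂(φ ∘ₘ P) := by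
  have h := Measure.integral_compProd (integrable_swap_compProd hF)
  have e : MeasurableEmbedding (Prod.swap : Profile n × M → M × Profile n) :=
    MeasurableEquiv.prodComm.measurableEmbedding
  rw [compProd_posterior_eq_map_swap, e.integral_map] at h
  simpa using h

theorem ae_memLp_posterior (hf : Measurable f) (hfP : MemLp f 2 P) :
    ∀ᵐ m ∂(φ ∘ₘ P), MemLp f 2 ((φ†P) m) := by
  have h2 : Integrable (fun p : Profile n × M => f p.1 ^ 2) (P ⊗ₘ φ) :=
    (hfP.comp_measurePreserving measurePreserving_fst_compProd).integrable_sq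
  have h := integrable_swap_compProd h2
  rw [Measure.integrable_compProd_iff h.aestronglyMeasurable] at h
  filter_upwards [h.1] with m hm
  exact (memLp_two_iff_integrable_sq hf.aestronglyMeasurable).2 hm

/-- Jensen's inequality, obtained here from nonnegativity of the posterior variance. -/
theorem memLp_posteriorMean (hf : Measurable f) (hfP : MemLp f 2 P) :
    MemLp (posteriorMean P φ f) 2 (φ ∘ₘ P) := by
  have h2 : Integrable (fun p : Profile n × M => f p.1 ^ 2) (P ⊗ₘ φ) :=
    (hfP.comp_measurePreserving measurePreserving_fst_compProd).integrable_sq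
  have h := integrable_swap_compProd h2
  rw [memLp_two_iff_integrable_sq (measurable_posteriorMean hf).aestronglyMeasurable]
  refine (Integrable.integral_compProd h).mono'
    ((measurable_posteriorMean hf).pow_const 2).aestronglyMeasurable ?_
  filter_upwards [ae_memLp_posterior (φ := φ) hf hfP] with m hm
  have hv := variance_nonneg f ((φ†P) m)
  rw [variance_eq_sub hm] at hv
  rw [Real.norm_of_nonneg (sq_nonneg _)]
  simpa [posteriorMean] using hv

theorem memLp_posteriorMean_snd (hf : Measurable f) (hfP : MemLp f 2 P) :
    MemLp (fun p : Profile n × M => posteriorMean P φ f p.2) 2 (P ⊗ₘ φ) :=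
  (memLp_posteriorMean hf hfP).comp_measurePreserving measurePreserving_snd_compProd

/-- The forecast error of `f` is orthogonal to every square-integrable function of the
realization. -/
theorem integral_mul_sub_posteriorMean (hf : Measurable f) (hfP : MemLp f 2 P) {h : M → ℝ}
    (hh : MemLp (fun p : Profile n × M => h p.2) 2 (P ⊗ₘ φ)) :
    ∫ p, h p.2 * (f p.1 - posteriorMean P φ f p.2) ∂(P ⊗ₘ φ) = 0 := by
  have hfρ : MemLp (fun p : Profile n × M => f p.1) 2 (P ⊗ₘ φ) :=
    hfP.comp_measurePreserving measurePreserving_fst_compProd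
  have hi : Integrable (fun p : Profile n × M => h p.2 * (f p.1 - posteriorMean P φ f p.2))
      (P ⊗ₘ φ) :=
    hh.integrable_mul (hfρ.sub (memLp_posteriorMean_snd hf hfP))
  rw [integral_compProd_eq_posterior hi]
  refine integral_eq_zero_of_ae ?_
  filter_upwards [ae_memLp_posterior (φ := φ) hf hfP] with m hm
  have := hm.integrable one_le_two
  simp only [Pi.zero_apply]
  rw [integral_const_mul, integral_sub this (integrable_const _)]
  simp [posteriorMean]

/-- A noiseless signal informs the agents of every function of its realization. -/
theorem informs_of_factor {T : Profile n → M} (hT : Measurable T) {g : M → ℝ}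
    (hg : Measurable g) (hf : Measurable f) (hfP : MemLp f 2 P) (hgT : ∀ x, g (T x) = f x) :
    Informs P (Kernel.deterministic T hT) f := by
  set ψ := Kernel.deterministic T hT with hψ
  have hfρ : MemLp (fun p : Profile n × M => f p.1) 2 (P ⊗ₘ ψ) :=
    hfP.comp_measurePreserving measurePreserving_fst_compProd
  have hcongr : (fun p : Profile n × M => g p.2) =ᵐ[P ⊗ₘ ψ] fun p => f p.1 := by
    rw [hψ, Measure.compProd_deterministic]
    refine (ae_map_iff (by fun_prop) ?_).2 (Filter.Eventually.of_forall fun x => hgT x)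
    exact measurableSet_eq_fun (by fun_prop) (by fun_prop)
  have hgρ : MemLp (fun p : Profile n × M => g p.2) 2 (P ⊗ₘ ψ) := hfρ.ae_eq hcongr.symm
  have hpm := memLp_posteriorMean_snd (φ := ψ) hf hfP
  -- The test function equals the forecast error itself almost everywhere, so orthogonality makes
  -- the mean square error vanish.
  have h0 := integral_mul_sub_posteriorMean (φ := ψ) hf hfP
    (h := fun m => g m - posteriorMean P ψ f m) (hgρ.sub hpm)
  have h1 : ∫ p, (f p.1 - posteriorMean P ψ f p.2) ^ 2 ∂(P ⊗ₘ ψ) = 0 := by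
    rw [← h0]
    refine integral_congr_ae ?_
    filter_upwards [hcongr] with p hp
    rw [hp, sq]
  filter_upwards [ae_eq_zero_of_integral_sq_eq_zero (hfρ.sub hpm) h1] with p hp
  exact (sub_eq_zero.1 hp).symm

/-- If the prior and a noiseless signal are invariant under `τ`, then a variable and its
transform under `τ` have the same posterior mean. -/
theorem posteriorMean_comp_eq {T : Profile n → M} (hT : Measurable T) {τ : Profile n → Profile n}
    (hτ : MeasurePreserving τ P P) (hTτ : ∀ x, T (τ x) = T x) (hf : Measurable f)
    (hfP : MemLp f 2 P) :
    ∀ᵐ p ∂(P ⊗ₘ Kernel.deterministic T hT),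
      posteriorMean P (Kernel.deterministic T hT) (fun x => f (τ x)) p.2 =
        posteriorMean P (Kernel.deterministic T hT) f p.2 := by
  set ψ := Kernel.deterministic T hT with hψ
  have hfτ : Measurable (fun x => f (τ x)) := hf.comp hτ.measurable
  have hfτP : MemLp (fun x => f (τ x)) 2 P := hfP.comp_measurePreserving hτ
  -- The difference of the two posterior means serves as test function for both orthogonality
  -- relations; subtracting them leaves the integral of `h`².
  set h : M → ℝ := fun m => posteriorMean P ψ (fun x => f (τ x)) m - posteriorMean P ψ f m
    with hh_def
  have hhm : Measurable h := (measurable_posteriorMean hfτ).sub (measurable_posteriorMean hf)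
  have hh : MemLp (fun p : Profile n × M => h p.2) 2 (P ⊗ₘ ψ) :=
    (memLp_posteriorMean_snd hfτ hfτP).sub (memLp_posteriorMean_snd hf hfP)
  have hfρ : MemLp (fun p : Profile n × M => f p.1) 2 (P ⊗ₘ ψ) :=
    hfP.comp_measurePreserving measurePreserving_fst_compProd
  have hfτρ : MemLp (fun p : Profile n × M => f (τ p.1)) 2 (P ⊗ₘ ψ) :=
    hfτP.comp_measurePreserving measurePreserving_fst_compProd
  have e1 := integral_mul_sub_posteriorMean (φ := ψ) hf hfP hh
  have e2 := integral_mul_sub_posteriorMean (φ := ψ) hfτ hfτP hh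
  have e3 : ∫ p, h p.2 * f (τ p.1) ∂(P ⊗ₘ ψ) = ∫ p, h p.2 * f p.1 ∂(P ⊗ₘ ψ) := by
    have m1 : Measurable fun p : Profile n × M => h p.2 * f (τ p.1) :=
      (hhm.comp measurable_snd).mul (hfτ.comp measurable_fst)
    have m2 : Measurable fun p : Profile n × M => h p.2 * f p.1 :=
      (hhm.comp measurable_snd).mul (hf.comp measurable_fst)
    rw [hψ, Measure.compProd_deterministic,
      integral_map (by fun_prop) (m1.aestronglyMeasurable),
      integral_map (by fun_prop) (m2.aestronglyMeasurable)]
    -- Change of variables along `τ`: the factor `h (T x)` is unaffected since `T` is invariant.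
    have := integral_map (μ := P) (φ := τ) hτ.measurable.aemeasurable
      (f := fun x => h (T x) * f x)
      ((hhm.comp hT).mul hf).aestronglyMeasurable
    rw [hτ.map_eq] at this
    simp only [hTτ] at this
    exact this.symm
  have i1 : Integrable (fun p => h p.2 * f p.1) (P ⊗ₘ ψ) := hh.integrable_mul hfρ
  have i2 : Integrable (fun p => h p.2 * f (τ p.1)) (P ⊗ₘ ψ) := hh.integrable_mul hfτρ
  have i3 : Integrable (fun p => h p.2 * posteriorMean P ψ f p.2) (P ⊗ₘ ψ) :=
    hh.integrable_mul (memLp_posteriorMean_snd hf hfP)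
  have i4 : Integrable (fun p => h p.2 * posteriorMean P ψ (fun x => f (τ x)) p.2) (P ⊗ₘ ψ) :=
    hh.integrable_mul (memLp_posteriorMean_snd hfτ hfτP)
  simp only [mul_sub] at e1 e2
  rw [integral_sub i1 i3] at e1
  rw [integral_sub i2 i4] at e2
  have h1 : ∫ p, h p.2 ^ 2 ∂(P ⊗ₘ ψ) = 0 := by
    have : ∫ p, h p.2 ^ 2 ∂(P ⊗ₘ ψ) =
        ∫ p, (h p.2 * posteriorMean P ψ (fun x => f (τ x)) p.2 -
          h p.2 * posteriorMean P ψ f p.2) ∂(P ⊗ₘ ψ) := by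
      refine integral_congr_ae (Filter.Eventually.of_forall fun p => ?_)
      simp only [hh_def]
      ring
    rw [this, integral_sub i4 i3]
    linarith
  filter_upwards [ae_eq_zero_of_integral_sq_eq_zero hh h1] with p hp
  exact sub_eq_zero.1 hp

end Posterior

/-! ### First-order characterization of Nash equilibrium. -/

section Equilibrium

variable {n : ℕ}

theorem integral_sub_sq {ν : Measure (Profile n)} [IsProbabilityMeasure ν] {i : Fin n}
    (h : MemLp (fun x : Profile n => x i) 2 ν) (b : ℝ) :
    ∫ x, (b - x i) ^ 2 ∂ν = b ^ 2 - 2 * b * ∫ x, x i ∂ν + ∫ x, x i ^ 2 ∂ν := by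
  have h1 : Integrable (fun x : Profile n => x i) ν := h.integrable one_le_two
  have h2 : Integrable (fun x : Profile n => x i ^ 2) ν := h.integrable_sq
  have : (fun x : Profile n => (b - x i) ^ 2) =
      fun x => (b ^ 2 - 2 * b * x i) + x i ^ 2 := by
    funext x; ring
  have h3 : Integrable (fun x : Profile n => b ^ 2 - 2 * b * x i) ν :=
    (integrable_const _).sub (h1.const_mul _)
  rw [this, integral_add h3 h2,
    integral_sub (integrable_const _) (h1.const_mul _), integral_const_mul]
  simp

theorem integral_agentPayoff {ν : Measure (Profile n)} [IsProbabilityMeasure ν] {i : Fin n}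
    (h : MemLp (fun x : Profile n => x i) 2 ν) (β : ℝ) (g : Matrix (Fin n) (Fin n) ℝ)
    (a : Profile n) :
    ∫ x, agentPayoff β g i a x ∂ν =
      -(a i ^ 2 - 2 * a i * ∫ x, x i ∂ν + ∫ x, x i ^ 2 ∂ν) -
        β * ∑ j, g i j * (a i - a j) ^ 2 := by
  have h2 : Integrable (fun x : Profile n => (a i - x i) ^ 2) ν :=
    ((memLp_const (a i)).sub h).integrable_sq
  unfold agentPayoff
  have h3 : Integrable (fun x : Profile n => -(a i - x i) ^ 2) ν := h2.neg
  rw [integral_sub h3 (integrable_const _), integral_neg, integral_sub_sq h]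
  simp

/-- A quadratic polynomial with nonnegative leading coefficient and no constant term is
nonnegative exactly when its linear coefficient vanishes. -/
theorem forall_quadratic_nonneg_iff {q l : ℝ} (hq : 0 ≤ q) :
    (∀ t : ℝ, 0 ≤ q * t ^ 2 + l * t) ↔ l = 0 := by
  refine ⟨fun h => ?_, fun h t => by
    rw [h, zero_mul, add_zero]; positivity⟩
  -- Dividing by `q + 1` instead of `q` covers the degenerate case `q = 0` and still gives a value
  -- of minus a square.
  have h1 := h (-l / (q + 1))
  have e : q * (-l / (q + 1)) ^ 2 + l * (-l / (q + 1)) = -(l ^ 2 / (q + 1) ^ 2) := by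
    field_simp
    ring
  rw [e] at h1
  have h2 : 0 ≤ l ^ 2 / (q + 1) ^ 2 := by positivity
  have h3 : l ^ 2 / (q + 1) ^ 2 = 0 := by linarith
  have h4 : (q + 1) ^ 2 ≠ 0 := by positivity
  simpa [h4] using h3

/-- Nash equilibria are the solutions of the first-order conditions. -/
theorem isNash_iff {ν : Measure (Profile n)} [IsProbabilityMeasure ν]
    (h : ∀ i, MemLp (fun x : Profile n => x i) 2 ν) {β : ℝ} (hβ : 0 ≤ β)
    {g : Matrix (Fin n) (Fin n) ℝ} (hg : ∀ i j, 0 ≤ g i j) (hd : ∀ i, g i i = 0)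
    (a : Profile n) :
    IsNash β g ν a ↔
      ∀ i, a i - ∫ x, x i ∂ν + β * ∑ j, g i j * (a i - a j) = 0 := by
  unfold IsNash
  refine forall_congr' fun i => ?_
  have hq : 0 ≤ 1 + β * ∑ j, g i j := by
    have := Finset.sum_nonneg fun j (_ : j ∈ Finset.univ) => hg i j
    positivity
  -- The loss from a deviation by `t` is exactly quadratic in `t`, so a unilateral optimum means
  -- that its linear coefficient vanishes. The zero diagonal of `g` is needed because the `j = i`
  -- term does not change under the deviation.
  have key : ∀ t : ℝ, ∫ x, agentPayoff β g i a x ∂ν -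
      ∫ x, agentPayoff β g i (Function.update a i (a i + t)) x ∂ν =
      (1 + β * ∑ j, g i j) * t ^ 2 +
        (2 * (a i - ∫ x, x i ∂ν + β * ∑ j, g i j * (a i - a j))) * t := by
    intro t
    rw [integral_agentPayoff (h i), integral_agentPayoff (h i)]
    have hs : ∑ j, g i j * (Function.update a i (a i + t) i -
        Function.update a i (a i + t) j) ^ 2 =
        ∑ j, g i j * (a i - a j) ^ 2 + 2 * t * ∑ j, g i j * (a i - a j) +
          t ^ 2 * ∑ j, g i j := by
      rw [Finset.mul_sum, Finset.mul_sum, ← Finset.sum_add_distrib, ← Finset.sum_add_distrib]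
      refine Finset.sum_congr rfl fun j _ => ?_
      by_cases hj : j = i
      · subst hj; simp [hd]
      · rw [Function.update_self, Function.update_of_ne hj]; ring
    rw [hs, Function.update_self]
    ring
  have hz : 2 * (a i - ∫ x, x i ∂ν + β * ∑ j, g i j * (a i - a j)) = 0 ↔
      a i - ∫ x, x i ∂ν + β * ∑ j, g i j * (a i - a j) = 0 := by simp
  rw [← hz, ← forall_quadratic_nonneg_iff hq]
  constructor
  · intro H t
    rw [← key]
    linarith [H (a i + t)]
  · intro H b
    have := H (b - a i)
    rw [← key] at this
    have e : a i + (b - a i) = b := by ring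
    rw [e] at this
    linarith

end Equilibrium

/-! ### The star game: equilibrium and the principal's reduced payoff. -/

section Star

variable {n : ℕ}

theorem sum_eq_core_add_sum_erase (c : Fin n) (f : Fin n → ℝ) :
    ∑ i, f i = f c + ∑ j ∈ Finset.univ.erase c, f j :=
  (Finset.add_sum_erase _ _ (Finset.mem_univ c)).symm

theorem sum_erase_const (c : Fin n) (r : ℝ) :
    ∑ _j ∈ Finset.univ.erase c, r = ((n : ℝ) - 1) * r := by
  have hn : 1 ≤ n := Fin.pos c
  simp [Nat.cast_sub hn]

theorem sum_erase_eq (hn : 2 ≤ n) (c : Fin n) (x : Profile n) :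
    ∑ j ∈ Finset.univ.erase c, x j = ((n : ℝ) - 1) * othersAverage c x := by
  have : (2 : ℝ) ≤ n := by exact_mod_cast hn
  have : (n : ℝ) - 1 ≠ 0 := by linarith
  unfold othersAverage
  field_simp

theorem starMatrix_nonneg (c i j : Fin n) : 0 ≤ starMatrix c i j := by
  unfold starMatrix
  rw [SimpleGraph.adjMatrix_apply]
  split_ifs <;> norm_num

theorem starMatrix_self (c i : Fin n) : starMatrix c i i = 0 := by
  simp [SimpleGraph.adjMatrix_apply]

theorem sum_starMatrix_core (c : Fin n) (f : Fin n → ℝ) :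
    ∑ j, starMatrix c c j * f j = ∑ j ∈ Finset.univ.erase c, f j := by
  rw [sum_eq_core_add_sum_erase c, starMatrix_self, zero_mul, zero_add]
  refine Finset.sum_congr rfl fun j hj => ?_
  have : c ≠ j := (Finset.ne_of_mem_erase hj).symm
  simp [SimpleGraph.adjMatrix_apply, this]

theorem sum_starMatrix_leaf {c i : Fin n} (hi : i ≠ c) (f : Fin n → ℝ) :
    ∑ j, starMatrix c i j * f j = f c := by
  rw [Finset.sum_eq_single c]
  · simp [SimpleGraph.adjMatrix_apply, hi]
  · intro j _ hj
    simp [SimpleGraph.adjMatrix_apply, hi, hj]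
  · simp

/-- The equilibrium action of the core, as a function of the posterior means. -/
noncomputable def coreAction (β : ℝ) (c : Fin n) (y : Profile n) : ℝ :=
  y c - β * ((n : ℝ) - 1) * (y c - othersAverage c y) / (1 + β * n)

/-- The equilibrium of the star game, as a function of the posterior means. -/
noncomputable def starEquilibrium (β : ℝ) (c : Fin n) (y : Profile n) : Profile n := fun i =>
  if i = c then coreAction β c y else (y i + β * coreAction β c y) / (1 + β)

theorem starEquilibrium_core (β : ℝ) (c : Fin n) (y : Profile n) :
    starEquilibrium β c y c = coreAction β c y := by simp [starEquilibrium]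

theorem starEquilibrium_leaf (β : ℝ) {c i : Fin n} (hi : i ≠ c) (y : Profile n) :
    starEquilibrium β c y i = (y i + β * coreAction β c y) / (1 + β) := by
  simp [starEquilibrium, hi]

/-- A leaf's condition involves only its own action and the core's, so it makes the leaf's action a
weighted mean of `y i` and `a c`. Substitution into the core's condition leaves one linear equation
in `a c`, with coefficient (1 + βn)/(1 + β); only the average of the leaves' means enters it. -/
theorem star_firstOrder_iff (hn : 2 ≤ n) {β : ℝ} (hβ : 0 ≤ β) (c : Fin n) (a y : Profile n) :
    (∀ i, a i - y i + β * ∑ j, starMatrix c i j * (a i - a j) = 0) ↔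
      a = starEquilibrium β c y := by
  have hn' : (2 : ℝ) ≤ n := by exact_mod_cast hn
  have hβ1 : 1 + β ≠ 0 := by positivity
  have hD : 1 + β * n ≠ 0 := by positivity
  have core : ∑ j, starMatrix c c j * (a c - a j) =
      ((n : ℝ) - 1) * a c - ∑ j ∈ Finset.univ.erase c, a j := by
    rw [sum_starMatrix_core c fun j => a c - a j, Finset.sum_sub_distrib, sum_erase_const]
  -- The core's action is a free parameter `r`: one direction uses `a c`, the other `coreAction`.
  have leaf : ∀ {r : ℝ}, (∀ i, i ≠ c → a i = (y i + β * r) / (1 + β)) →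
      ∑ j ∈ Finset.univ.erase c, a j =
        ((n : ℝ) - 1) * (othersAverage c y + β * r) / (1 + β) := by
    intro r hr
    rw [Finset.sum_congr rfl fun j hj => hr j (Finset.ne_of_mem_erase hj), ← Finset.sum_div,
      Finset.sum_add_distrib, sum_erase_const, sum_erase_eq hn]
    ring
  constructor
  · intro H
    have hl : ∀ i, i ≠ c → a i = (y i + β * a c) / (1 + β) := by
      intro i hi
      have := H i
      rw [sum_starMatrix_leaf hi fun j => a i - a j] at this
      rw [eq_div_iff hβ1]
      linarith
    have hc := H c
    rw [core, leaf hl] at hc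
    have hac : a c = coreAction β c y := by
      unfold coreAction
      field_simp at hc ⊢
      linear_combination hc
    funext i
    by_cases hi : i = c
    · subst hi; rw [starEquilibrium_core, hac]
    · rw [starEquilibrium_leaf β hi, hl i hi, hac]
  · intro H i
    by_cases hi : i = c
    · subst hi
      rw [core, leaf (r := coreAction β i y) fun j hj => by rw [H, starEquilibrium_leaf β hj],
        H, starEquilibrium_core]
      unfold coreAction
      field_simp
      ring
    · rw [sum_starMatrix_leaf hi fun j => a i - a j, H, starEquilibrium_core,
        starEquilibrium_leaf β hi]
      field_simp
      ring

/-- The quadratic form `x_c² + (n - 1) x̄² - k (x_c - x̄)²` in the state of the core and the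
average state `x̄` of the others. -/
noncomputable def coreForm (k : ℝ) (c : Fin n) (x : Profile n) : ℝ :=
  x c ^ 2 + ((n : ℝ) - 1) * othersAverage c x ^ 2 - k * (x c - othersAverage c x) ^ 2

/-- The dispersion of the states of the agents other than `c` around their average. -/
noncomputable def dispersion (c : Fin n) (x : Profile n) : ℝ :=
  ∑ j ∈ Finset.univ.erase c, (x j - othersAverage c x) ^ 2

theorem dispersion_nonneg (c : Fin n) (x : Profile n) : 0 ≤ dispersion c x :=
  Finset.sum_nonneg fun _ _ => sq_nonneg _

theorem dispersion_eq_zero_iff (c : Fin n) (x : Profile n) :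
    dispersion c x = 0 ↔ ∀ j, j ≠ c → x j = othersAverage c x := by
  unfold dispersion
  rw [Finset.sum_eq_zero_iff_of_nonneg fun _ _ => sq_nonneg _]
  simp [sub_eq_zero]

theorem dispersion_eq (hn : 2 ≤ n) (c : Fin n) (x : Profile n) :
    dispersion c x =
      ∑ j ∈ Finset.univ.erase c, x j ^ 2 - ((n : ℝ) - 1) * othersAverage c x ^ 2 := by
  have : ∀ j, (x j - othersAverage c x) ^ 2 =
      x j ^ 2 - 2 * othersAverage c x * x j + othersAverage c x ^ 2 := fun j => by ring
  unfold dispersion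
  simp only [this]
  rw [Finset.sum_add_distrib, Finset.sum_sub_distrib, ← Finset.mul_sum,
    sum_erase_eq hn c x, sum_erase_const]
  ring

/-- The loss from miscoordination between the core and the others. -/
noncomputable def coreLoss (n : ℕ) (β : ℝ) : ℝ :=
  β * ((n : ℝ) - 1) * (β * n + 2) / (1 + β * n) ^ 2

/-- The principal's marginal value of dispersion in the others' posterior means. -/
noncomputable def dispersionValue (n : ℕ) (β : ℝ) : ℝ :=
  (1 - 2 * β * ((n : ℝ) - 1)) / (1 + β) ^ 2

/-- The form is diagonal in the coordinates p + (n-1)q and p - q. The loss constant reduces the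
weight of (p - q)² from (n-1)/n to (n-1)/(n(1+βn)²), which remains positive. -/
theorem coreForm_pos_def (hn : 2 ≤ n) {β : ℝ} (hβ : 0 ≤ β) (c : Fin n) (x : Profile n) :
    0 ≤ coreForm (coreLoss n β) c x ∧
      (coreForm (coreLoss n β) c x = 0 → x c = 0 ∧ othersAverage c x = 0) := by
  have hn' : (2 : ℝ) ≤ n := by exact_mod_cast hn
  have hn0 : (0 : ℝ) < n := by linarith
  have hD : 0 < 1 + β * n := by positivity
  set p := x c
  set q := othersAverage c x
  have e : coreForm (coreLoss n β) c x =
      (p + ((n : ℝ) - 1) * q) ^ 2 / n +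
        ((n : ℝ) - 1) * (p - q) ^ 2 / (n * (1 + β * n) ^ 2) := by
    simp only [coreForm, coreLoss]
    field_simp
    ring
  have h1 : 0 ≤ (p + ((n : ℝ) - 1) * q) ^ 2 / n := by positivity
  have hm : 0 < (n : ℝ) - 1 := by linarith
  have h2 : 0 ≤ ((n : ℝ) - 1) * (p - q) ^ 2 / (n * (1 + β * n) ^ 2) := by positivity
  refine ⟨by rw [e]; positivity, fun h => ?_⟩
  rw [e] at h
  have z1 : (p + ((n : ℝ) - 1) * q) ^ 2 / n = 0 := by linarith
  have z2 : ((n : ℝ) - 1) * (p - q) ^ 2 / (n * (1 + β * n) ^ 2) = 0 := by linarith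
  have w1 : p + ((n : ℝ) - 1) * q = 0 := by simpa [hn0.ne'] using z1
  have w2 : p - q = 0 := by simpa [hn0.ne', hD.ne', hm.ne'] using z2
  have hq : (n : ℝ) * q = 0 := by linear_combination w1 - w2
  have hq0 : q = 0 := by simpa [hn0.ne'] using hq
  exact ⟨by linarith, hq0⟩

/-- On the complete graph the miscoordination cost depends on the actions only through their sum and
their sum of squares. -/
theorem principalPayoff_complete (β : ℝ) (a x : Profile n) :
    principalPayoff β (completeMatrix n) a x =
      -∑ i, x i ^ 2 + 2 * ∑ i, a i * x i - ∑ i, a i ^ 2 -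
        2 * β * (n * ∑ i, a i ^ 2 - (∑ i, a i) ^ 2) := by
  have h1 : ∑ i, (a i - x i) ^ 2 = ∑ i, a i ^ 2 - 2 * ∑ i, a i * x i + ∑ i, x i ^ 2 := by
    rw [Finset.mul_sum, ← Finset.sum_sub_distrib, ← Finset.sum_add_distrib]
    exact Finset.sum_congr rfl fun i _ => by ring
  have h2 : ∀ i, ∑ j, completeMatrix n i j * (a i - a j) ^ 2 =
      n * a i ^ 2 - 2 * a i * ∑ j, a j + ∑ j, a j ^ 2 := by
    intro i
    have : ∀ j, completeMatrix n i j * (a i - a j) ^ 2 =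
        a i ^ 2 - 2 * a i * a j + a j ^ 2 := by
      intro j
      by_cases hij : i = j
      · subst hij; simp; ring
      · simp [SimpleGraph.adjMatrix_apply, hij]; ring
    simp only [this]
    rw [Finset.sum_add_distrib, Finset.sum_sub_distrib, ← Finset.mul_sum]
    simp
  unfold principalPayoff
  simp only [h2]
  rw [h1, Finset.sum_add_distrib, Finset.sum_sub_distrib, ← Finset.mul_sum, ← Finset.sum_mul,
    ← Finset.mul_sum]
  simp
  ring

/-- In equilibrium, the principal's payoff is a quadratic form in the posterior means, up to a
term that is linear in the forecast errors and one that does not depend on the signal. -/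
theorem principalPayoff_starEquilibrium (hn : 2 ≤ n) {β : ℝ} (hβ : 0 ≤ β) (c : Fin n)
    (y x : Profile n) :
    principalPayoff β (completeMatrix n) (starEquilibrium β c y) x =
      coreForm (coreLoss n β) c y + dispersionValue n β * dispersion c y - ∑ i, x i ^ 2 +
        ∑ i, 2 * starEquilibrium β c y i * (x i - y i) := by
  have hn' : (2 : ℝ) ≤ n := by exact_mod_cast hn
  have hβ1 : 1 + β ≠ 0 := by positivity
  have hD : 1 + β * n ≠ 0 := by positivity
  set a := starEquilibrium β c y with ha
  set r := coreAction β c y with hr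
  set Y := othersAverage c y with hY
  set Z := ∑ j ∈ Finset.univ.erase c, y j ^ 2 with hZ
  have leaf : ∀ j ∈ Finset.univ.erase c, a j = (y j + β * r) / (1 + β) := fun j hj =>
    starEquilibrium_leaf β (Finset.ne_of_mem_erase hj) y
  have s0 : ∑ j ∈ Finset.univ.erase c, y j = ((n : ℝ) - 1) * Y := sum_erase_eq hn c y
  have s1 : ∑ i, a i = r + ((n : ℝ) - 1) * (Y + β * r) / (1 + β) := by
    rw [sum_eq_core_add_sum_erase c, Finset.sum_congr rfl leaf, ← Finset.sum_div,
      Finset.sum_add_distrib, sum_erase_const, s0, ha, starEquilibrium_core]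
    ring
  have s2 : ∑ i, a i ^ 2 = r ^ 2 +
      (Z + 2 * β * r * (((n : ℝ) - 1) * Y) + ((n : ℝ) - 1) * (β * r) ^ 2) / (1 + β) ^ 2 := by
    have : ∀ j ∈ Finset.univ.erase c, a j ^ 2 =
        (y j ^ 2 + 2 * β * r * y j + (β * r) ^ 2) / (1 + β) ^ 2 := fun j hj => by
      rw [leaf j hj, div_pow]; ring
    rw [sum_eq_core_add_sum_erase c, Finset.sum_congr rfl this, ← Finset.sum_div,
      Finset.sum_add_distrib, Finset.sum_add_distrib, ← Finset.mul_sum, sum_erase_const, s0, ha,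
      starEquilibrium_core]
  have s3 : ∑ i, a i * y i = r * y c + (Z + β * r * (((n : ℝ) - 1) * Y)) / (1 + β) := by
    have : ∀ j ∈ Finset.univ.erase c, a j * y j =
        (y j ^ 2 + β * r * y j) / (1 + β) := fun j hj => by
      rw [leaf j hj]; ring
    rw [sum_eq_core_add_sum_erase c, Finset.sum_congr rfl this, ← Finset.sum_div,
      Finset.sum_add_distrib, ← Finset.mul_sum, s0, ha, starEquilibrium_core]
  have s4 : ∑ i, 2 * a i * (x i - y i) = 2 * ∑ i, a i * x i - 2 * ∑ i, a i * y i := by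
    rw [Finset.mul_sum, Finset.mul_sum, ← Finset.sum_sub_distrib]
    exact Finset.sum_congr rfl fun i _ => by ring
  rw [principalPayoff_complete, s4, s1, s2, s3, dispersion_eq hn, ← hZ, ← hY]
  simp only [coreForm, ← hY, coreLoss, dispersionValue]
  -- With the sums made opaque, what remains is a rational identity.
  have hr' : r = y c - β * ((n : ℝ) - 1) * (y c - Y) / (1 + β * n) := rfl
  clear_value r Z Y a
  subst hr'
  field_simp
  ring

end Star

/-! ### Expected quadratic forms and the principal's value. -/

section Value

variable {n : ℕ}

theorem measurable_dispersion (c : Fin n) : Measurable (dispersion c : Profile n → ℝ) := by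
  have := measurable_othersAverage c
  unfold dispersion
  fun_prop

theorem measurable_coreForm (k : ℝ) (c : Fin n) :
    Measurable (coreForm k c : Profile n → ℝ) := by
  have := measurable_othersAverage c
  unfold coreForm
  fun_prop

theorem measurable_starEquilibrium (β : ℝ) (c : Fin n) :
    Measurable (starEquilibrium β c : Profile n → Profile n) := by
  have := measurable_othersAverage c
  refine measurable_pi_iff.2 fun i => ?_
  unfold starEquilibrium coreAction
  split_ifs <;> fun_prop

theorem othersAverage_sub (c : Fin n) (x y : Profile n) :
    othersAverage c (x - y) = othersAverage c x - othersAverage c y := by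
  simp [othersAverage, Finset.sum_sub_distrib, sub_div]

/-- Exact second-order expansion at `y`. The derivative in the others' average is shared equally,
hence the division by `n - 1`. -/
theorem coreForm_eq_add (hn : 2 ≤ n) (k : ℝ) (c : Fin n) (x y : Profile n) :
    coreForm k c x = coreForm k c y + coreForm k c (x - y) +
      ∑ i, (if i = c then 2 * (y c - k * (y c - othersAverage c y)) else
        2 * othersAverage c y + 2 * k / ((n : ℝ) - 1) * (y c - othersAverage c y)) *
          (x i - y i) := by
  have hn' : (2 : ℝ) ≤ n := by exact_mod_cast hn
  have hm : (n : ℝ) - 1 ≠ 0 := by linarith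
  have hs := othersAverage_sub c x y
  rw [sum_eq_core_add_sum_erase c, if_pos rfl,
    Finset.sum_congr rfl fun j hj => by rw [if_neg (Finset.ne_of_mem_erase hj)],
    ← Finset.mul_sum, Finset.sum_sub_distrib, sum_erase_eq hn, sum_erase_eq hn]
  simp only [coreForm, hs, Pi.sub_apply]
  field_simp
  ring

/-- Exact second-order expansion at `y`. The average contributes nothing to the gradient because the
deviations from it sum to zero. -/
theorem dispersion_eq_add (hn : 2 ≤ n) (c : Fin n) (x y : Profile n) :
    dispersion c x = dispersion c y + dispersion c (x - y) +
      ∑ i, (if i = c then 0 else 2 * (y i - othersAverage c y)) * (x i - y i) := by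
  have hs := othersAverage_sub c x y
  have h1 : ∀ j, (x - y) j ^ 2 = x j ^ 2 - 2 * (y j * x j) + y j ^ 2 := fun j => by
    rw [Pi.sub_apply]; ring
  have h2 : ∀ j ∈ Finset.univ.erase c,
      (if j = c then 0 else 2 * (y j - othersAverage c y)) * (x j - y j) =
        2 * (y j * x j) - 2 * y j ^ 2 - 2 * othersAverage c y * x j +
          2 * othersAverage c y * y j := fun j hj => by
    rw [if_neg (Finset.ne_of_mem_erase hj)]; ring
  rw [sum_eq_core_add_sum_erase c, if_pos rfl, Finset.sum_congr rfl h2,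
    Finset.sum_add_distrib, Finset.sum_sub_distrib, Finset.sum_sub_distrib, ← Finset.mul_sum,
    ← Finset.mul_sum, ← Finset.mul_sum, ← Finset.mul_sum, dispersion_eq hn, dispersion_eq hn,
    dispersion_eq hn, hs, sum_erase_eq hn c x, sum_erase_eq hn c y]
  simp only [h1]
  rw [Finset.sum_add_distrib, Finset.sum_sub_distrib, ← Finset.mul_sum]
  ring

section Integrability

variable {Ω : Type*} [MeasurableSpace Ω] {ρ : Measure Ω} {w : Ω → Profile n}

theorem memLp_othersAverage (hw : ∀ i, MemLp (fun ω => w ω i) 2 ρ) (c : Fin n) :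
    MemLp (fun ω => othersAverage c (w ω)) 2 ρ := by
  simp only [othersAverage, div_eq_mul_inv]
  exact (memLp_finsetSum _ fun j _ => hw j).mul_const _

theorem memLp_starEquilibrium (hw : ∀ i, MemLp (fun ω => w ω i) 2 ρ) (β : ℝ) (c i : Fin n) :
    MemLp (fun ω => starEquilibrium β c (w ω) i) 2 ρ := by
  have hc : MemLp (fun ω => coreAction β c (w ω)) 2 ρ := by
    simp only [coreAction, div_eq_mul_inv]
    exact (hw c).sub ((((hw c).sub (memLp_othersAverage hw c)).const_mul _).mul_const _)
  unfold starEquilibrium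
  split_ifs
  · exact hc
  · simp only [div_eq_mul_inv]
    exact ((hw i).add (hc.const_mul _)).mul_const _

theorem integrable_coreForm (hw : ∀ i, MemLp (fun ω => w ω i) 2 ρ) (k : ℝ) (c : Fin n) :
    Integrable (fun ω => coreForm k c (w ω)) ρ :=
  ((hw c).integrable_sq.add ((memLp_othersAverage hw c).integrable_sq.const_mul _)).sub
    (((hw c).sub (memLp_othersAverage hw c)).integrable_sq.const_mul _)

theorem integrable_dispersion (hw : ∀ i, MemLp (fun ω => w ω i) 2 ρ) (c : Fin n) :
    Integrable (fun ω => dispersion c (w ω)) ρ :=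
  integrable_finsetSum _ fun j _ => ((hw j).sub (memLp_othersAverage hw c)).integrable_sq

end Integrability

variable {M : Type u} [MeasurableSpace M] {P : Measure (Profile n)} [IsProbabilityMeasure P]
  {φ : Kernel (Profile n) M} [IsMarkovKernel φ]

/-- The vector of posterior means of the agents' states. -/
noncomputable def posteriorMeans (P : Measure (Profile n)) [IsFiniteMeasure P]
    (φ : Kernel (Profile n) M) [IsMarkovKernel φ] (m : M) : Profile n :=
  fun i => posteriorMean P φ (fun x => x i) m

theorem measurable_posteriorMeans : Measurable (posteriorMeans P φ) :=
  measurable_pi_iff.2 fun i => measurable_posteriorMean (measurable_pi_apply i)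

theorem memLp_state
    (hP : ∀ i, MemLp (fun x : Profile n => x i) 2 P)
    (i : Fin n) : MemLp (fun p : Profile n × M => p.1 i) 2 (P ⊗ₘ φ) :=
  (hP i).comp_measurePreserving measurePreserving_fst_compProd

theorem memLp_posteriorMeans
    (hP : ∀ i, MemLp (fun x : Profile n => x i) 2 P)
    (i : Fin n) :
    MemLp (fun p : Profile n × M => posteriorMeans P φ p.2 i) 2 (P ⊗ₘ φ) :=
  memLp_posteriorMean_snd (measurable_pi_apply i) (hP i)

theorem memLp_forecastError
    (hP : ∀ i, MemLp (fun x : Profile n => x i) 2 P)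
    (i : Fin n) :
    MemLp (fun p : Profile n × M => (p.1 - posteriorMeans P φ p.2) i) 2 (P ⊗ₘ φ) :=
  (memLp_state hP i).sub (memLp_posteriorMeans hP i)

theorem ae_forall_memLp_posterior
    (hP : ∀ i, MemLp (fun x : Profile n => x i) 2 P) :
    ∀ᵐ m ∂(φ ∘ₘ P), ∀ i, MemLp (fun x : Profile n => x i) 2 ((φ†P) m) :=
  ae_all_iff.2 fun i => ae_memLp_posterior (measurable_pi_apply i) (hP i)

theorem posteriorMean_othersAverage
    (hP : ∀ i, MemLp (fun x : Profile n => x i) 2 P)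
    (c : Fin n) :
    ∀ᵐ m ∂(φ ∘ₘ P),
      posteriorMean P φ (othersAverage c) m = othersAverage c (posteriorMeans P φ m) := by
  filter_upwards [ae_forall_memLp_posterior (φ := φ) hP] with m hm
  unfold posteriorMean posteriorMeans othersAverage posteriorMean
  rw [integral_div, integral_finsetSum _ fun j _ => (hm j).integrable one_le_two]

theorem integrable_mul_forecastError
    (hP : ∀ i, MemLp (fun x : Profile n => x i) 2 P) {G : M → Profile n}
    (hG : ∀ i, MemLp (fun p : Profile n × M => G p.2 i) 2 (P ⊗ₘ φ)) (i : Fin n) :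
    Integrable (fun p : Profile n × M => G p.2 i * (p.1 i - posteriorMeans P φ p.2 i))
      (P ⊗ₘ φ) :=
  (hG i).integrable_mul (memLp_forecastError hP i)

theorem integral_sum_mul_forecastError
    (hP : ∀ i, MemLp (fun x : Profile n => x i) 2 P) {G : M → Profile n}
    (hG : ∀ i, MemLp (fun p : Profile n × M => G p.2 i) 2 (P ⊗ₘ φ)) :
    ∫ p, ∑ i, G p.2 i * (p.1 i - posteriorMeans P φ p.2 i) ∂(P ⊗ₘ φ) = 0 := by
  rw [integral_finsetSum _ fun i _ => integrable_mul_forecastError hP hG i]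
  exact Finset.sum_eq_zero fun i _ =>
    integral_mul_sub_posteriorMean (h := fun m => G m i) (measurable_pi_apply i) (hP i) (hG i)

/-- Terms linear in the forecast error, with coefficients depending on the realization, integrate to
zero. An almost sure identity suffices, as equilibrium play is pinned down only up to null sets. -/
theorem integral_eq_add_of_forecastError
    (hP : ∀ i, MemLp (fun x : Profile n => x i) 2 P) {F F₁ F₂ : Profile n × M → ℝ}
    {G : M → Profile n} (h₁ : Integrable F₁ (P ⊗ₘ φ)) (h₂ : Integrable F₂ (P ⊗ₘ φ))
    (hG : ∀ i, MemLp (fun p : Profile n × M => G p.2 i) 2 (P ⊗ₘ φ))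
    (h : ∀ᵐ p ∂(P ⊗ₘ φ), F p = F₁ p + F₂ p +
      ∑ i, G p.2 i * (p.1 i - posteriorMeans P φ p.2 i)) :
    ∫ p, F p ∂(P ⊗ₘ φ) = ∫ p, F₁ p ∂(P ⊗ₘ φ) + ∫ p, F₂ p ∂(P ⊗ₘ φ) := by
  have h₁₂ : Integrable (fun p => F₁ p + F₂ p) (P ⊗ₘ φ) := h₁.add h₂
  have h₃ : Integrable (fun p : Profile n × M =>
      ∑ i, G p.2 i * (p.1 i - posteriorMeans P φ p.2 i)) (P ⊗ₘ φ) :=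
    integrable_finsetSum _ fun i _ => integrable_mul_forecastError hP hG i
  rw [integral_congr_ae h, integral_add h₁₂ h₃, integral_sum_mul_forecastError hP hG, add_zero,
    integral_add h₁ h₂]

/-- Pythagoras for the core form. The left side does not depend on the signal, so maximizing the
form of the posterior means is minimizing that of the forecast error. -/
theorem integral_coreForm_eq_add
    (hP : ∀ i, MemLp (fun x : Profile n => x i) 2 P)
    (hn : 2 ≤ n) (k : ℝ) (c : Fin n) :
    ∫ x, coreForm k c x ∂P =
      ∫ p, coreForm k c (posteriorMeans P φ p.2) ∂(P ⊗ₘ φ) +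
        ∫ p, coreForm k c (p.1 - posteriorMeans P φ p.2) ∂(P ⊗ₘ φ) := by
  set G : M → Profile n := fun m i =>
    if i = c then 2 * (posteriorMeans P φ m c -
      k * (posteriorMeans P φ m c - othersAverage c (posteriorMeans P φ m))) else
      2 * othersAverage c (posteriorMeans P φ m) + 2 * k / ((n : ℝ) - 1) *
        (posteriorMeans P φ m c - othersAverage c (posteriorMeans P φ m)) with hG_def
  have hy := memLp_posteriorMeans (φ := φ) hP
  have hY := memLp_othersAverage (w := fun p : Profile n × M => posteriorMeans P φ p.2) hy c
  have hG : ∀ i, MemLp (fun p : Profile n × M => G p.2 i) 2 (P ⊗ₘ φ) := by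
    intro i
    simp only [hG_def]
    split_ifs
    · exact ((hy c).sub (((hy c).sub hY).const_mul _)).const_mul _
    · exact (hY.const_mul _).add (((hy c).sub hY).const_mul _)
  rw [← integral_state_compProd (φ := φ) (measurable_coreForm k c)]
  exact integral_eq_add_of_forecastError hP (integrable_coreForm hy k c)
    (integrable_coreForm (memLp_forecastError hP) k c) hG
    (Filter.Eventually.of_forall fun p =>
      coreForm_eq_add hn k c p.1 (posteriorMeans P φ p.2))

theorem integral_dispersion_eq_add
    (hP : ∀ i, MemLp (fun x : Profile n => x i) 2 P)
    (hn : 2 ≤ n) (c : Fin n) :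
    ∫ x, dispersion c x ∂P =
      ∫ p, dispersion c (posteriorMeans P φ p.2) ∂(P ⊗ₘ φ) +
        ∫ p, dispersion c (p.1 - posteriorMeans P φ p.2) ∂(P ⊗ₘ φ) := by
  set G : M → Profile n := fun m i =>
    if i = c then 0 else
      2 * (posteriorMeans P φ m i - othersAverage c (posteriorMeans P φ m)) with hG_def
  have hy := memLp_posteriorMeans (φ := φ) hP
  have hY := memLp_othersAverage (w := fun p : Profile n × M => posteriorMeans P φ p.2) hy c
  have hG : ∀ i, MemLp (fun p : Profile n × M => G p.2 i) 2 (P ⊗ₘ φ) := by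
    intro i
    simp only [hG_def]
    split_ifs
    · exact memLp_const 0
    · exact ((hy i).sub hY).const_mul _
  rw [← integral_state_compProd (φ := φ) (measurable_dispersion c)]
  exact integral_eq_add_of_forecastError hP (integrable_dispersion hy c)
    (integrable_dispersion (memLp_forecastError hP) c) hG
    (Filter.Eventually.of_forall fun p =>
      dispersion_eq_add hn c p.1 (posteriorMeans P φ p.2))

theorem isEquilibrium_iff
    (hP : ∀ i, MemLp (fun x : Profile n => x i) 2 P)
    (hn : 2 ≤ n) {β : ℝ} (hβ : 0 ≤ β) (c : Fin n) {a : M → Profile n} :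
    IsEquilibrium β (starMatrix c) P φ a ↔
      Measurable a ∧ ∀ᵐ m ∂(φ ∘ₘ P), a m = starEquilibrium β c (posteriorMeans P φ m) := by
  refine and_congr_right fun _ => Filter.eventually_congr ?_
  filter_upwards [ae_forall_memLp_posterior (φ := φ) hP] with m hm
  rw [isNash_iff hm hβ (starMatrix_nonneg c) (starMatrix_self c)]
  exact star_firstOrder_iff hn hβ c (a m) (posteriorMeans P φ m)

theorem isEquilibrium_starEquilibrium
    (hP : ∀ i, MemLp (fun x : Profile n => x i) 2 P)
    (hn : 2 ≤ n) {β : ℝ} (hβ : 0 ≤ β) (c : Fin n) :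
    IsEquilibrium β (starMatrix c) P φ fun m => starEquilibrium β c (posteriorMeans P φ m) :=
  (isEquilibrium_iff hP hn hβ c).2
    ⟨(measurable_starEquilibrium β c).comp measurable_posteriorMeans,
      Filter.Eventually.of_forall fun _ => rfl⟩

/-- The principal's value is an affine function of the expected quadratic forms of the
posterior means. -/
theorem principalValue_eq
    (hP : ∀ i, MemLp (fun x : Profile n => x i) 2 P)
    (hn : 2 ≤ n) {β : ℝ} (hβ : 0 ≤ β) (c : Fin n) {a : M → Profile n}
    (ha : IsEquilibrium β (starMatrix c) P φ a) :
    principalValue β (completeMatrix n) P φ a =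
      ∫ p, coreForm (coreLoss n β) c (posteriorMeans P φ p.2) ∂(P ⊗ₘ φ) +
        dispersionValue n β * ∫ p, dispersion c (posteriorMeans P φ p.2) ∂(P ⊗ₘ φ) -
          ∫ x, ∑ i, x i ^ 2 ∂P := by
  have hae := measurePreserving_snd_compProd.quasiMeasurePreserving.ae
    ((isEquilibrium_iff hP hn hβ c).1 ha).2
  have hy := memLp_posteriorMeans (φ := φ) hP
  have hG : ∀ i, MemLp (fun p : Profile n × M =>
      2 * starEquilibrium β c (posteriorMeans P φ p.2) i) 2 (P ⊗ₘ φ) := fun i =>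
    (memLp_starEquilibrium hy β c i).const_mul 2
  have i1 := integrable_coreForm hy (coreLoss n β) c
  have i2 := (integrable_dispersion hy c).const_mul (dispersionValue n β)
  have i3 : Integrable (fun p : Profile n × M => ∑ i, p.1 i ^ 2) (P ⊗ₘ φ) :=
    integrable_finsetSum _ fun i _ => (memLp_state hP i).integrable_sq
  have i12 : Integrable (fun p : Profile n × M =>
      coreForm (coreLoss n β) c (posteriorMeans P φ p.2) +
        dispersionValue n β * dispersion c (posteriorMeans P φ p.2)) (P ⊗ₘ φ) := i1.add i2
  have i3' : Integrable (fun p : Profile n × M => -∑ i, p.1 i ^ 2) (P ⊗ₘ φ) := i3.neg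
  rw [← integral_state_compProd (P := P) (φ := φ) (f := fun x => ∑ i, x i ^ 2) (by fun_prop),
    ← integral_const_mul, ← integral_add i1 i2, sub_eq_add_neg, ← integral_neg]
  refine integral_eq_add_of_forecastError hP i12 i3'
    (G := fun m i => 2 * starEquilibrium β c (posteriorMeans P φ m) i) hG ?_
  filter_upwards [hae] with p hp
  rw [hp, principalPayoff_starEquilibrium hn hβ c]
  ring

theorem integral_coreForm_forecastError_nonneg (hn : 2 ≤ n) {β : ℝ} (hβ : 0 ≤ β) (c : Fin n) :
    0 ≤ ∫ p, coreForm (coreLoss n β) c (p.1 - posteriorMeans P φ p.2) ∂(P ⊗ₘ φ) :=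
  integral_nonneg fun _ => (coreForm_pos_def hn hβ c _).1

/-- The expected loss in the core form vanishes exactly when the core's state and the average
state of the others are disclosed. -/
theorem integral_coreForm_forecastError_eq_zero_iff
    (hP : ∀ i, MemLp (fun x : Profile n => x i) 2 P)
    (hn : 2 ≤ n) {β : ℝ} (hβ : 0 ≤ β)
    (c : Fin n) :
    ∫ p, coreForm (coreLoss n β) c (p.1 - posteriorMeans P φ p.2) ∂(P ⊗ₘ φ) = 0 ↔
      Informs P φ (fun x => x c) ∧ Informs P φ (othersAverage c) := by
  have hpos : ∀ p : Profile n × M, 0 ≤ coreForm (coreLoss n β) c (p.1 - posteriorMeans P φ p.2) :=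
    fun _ => (coreForm_pos_def hn hβ c _).1
  have havg := measurePreserving_snd_compProd.quasiMeasurePreserving.ae
    (posteriorMean_othersAverage (φ := φ) hP c)
  rw [integral_eq_zero_iff_of_nonneg hpos
    (integrable_coreForm (memLp_forecastError hP) _ c)]
  constructor
  · intro h
    constructor
    · filter_upwards [h] with p hp
      have := ((coreForm_pos_def hn hβ c _).2 hp).1
      exact (sub_eq_zero.1 this).symm
    · filter_upwards [h, havg] with p hp hp'
      have := ((coreForm_pos_def hn hβ c _).2 hp).2
      rw [othersAverage_sub] at this
      rw [hp']
      exact (sub_eq_zero.1 this).symm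
  · rintro ⟨h1, h2⟩
    filter_upwards [h1, h2, havg] with p hp1 hp2 hp3
    have e1 : (p.1 - posteriorMeans P φ p.2) c = 0 := by
      rw [Pi.sub_apply, sub_eq_zero]; exact hp1.symm
    have e2 : othersAverage c (p.1 - posteriorMeans P φ p.2) = 0 := by
      rw [othersAverage_sub, sub_eq_zero, ← hp3, hp2]
    simp [coreForm, e1, e2]

theorem integral_dispersion_eq_zero_iff
    (hP : ∀ i, MemLp (fun x : Profile n => x i) 2 P)
    (c : Fin n) :
    ∫ p, dispersion c (posteriorMeans P φ p.2) ∂(P ⊗ₘ φ) = 0 ↔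
      ∀ᵐ p ∂(P ⊗ₘ φ), ∀ j, j ≠ c →
        posteriorMeans P φ p.2 j = othersAverage c (posteriorMeans P φ p.2) := by
  rw [integral_eq_zero_iff_of_nonneg (fun _ => dispersion_nonneg c _)
    (integrable_dispersion (memLp_posteriorMeans hP) c)]
  refine Filter.eventually_congr (Filter.Eventually.of_forall fun p => ?_)
  exact dispersion_eq_zero_iff c _

end Value

/-! ### Exchangeability of the prior and the values of the two candidate signals. -/

section Prior

variable {n : ℕ}

theorem memLp_prior (μ : ℝ) (s : ℝ≥0) (i : Fin n) :
    MemLp (fun x : Profile n => x i) 2 (prior n μ s) :=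
  (memLp_id_gaussianReal (μ := μ) (v := s) 2).comp_measurePreserving
    (measurePreserving_eval (fun _ : Fin n => gaussianReal μ s) i)

theorem measurePreserving_permute_prior (μ : ℝ) (s : ℝ≥0) (e : Equiv.Perm (Fin n)) :
    MeasurePreserving (fun x : Profile n => x ∘ e) (prior n μ s) (prior n μ s) := by
  have h := measurePreserving_piCongrLeft (α := fun _ : Fin n => ℝ)
    (fun _ : Fin n => gaussianReal μ s) e.symm
  convert h using 1
  funext x i
  have := MeasurableEquiv.piCongrLeft_apply_apply e.symm (β := fun _ : Fin n => ℝ) x (e i)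
  simpa using this.symm

/-- A permutation preserves the total of all states, and this one fixes `c`. -/
theorem othersAverage_swap {c j k : Fin n} (hj : j ≠ c) (hk : k ≠ c) (x : Profile n) :
    othersAverage c (x ∘ Equiv.swap j k) = othersAverage c x := by
  have h1 := sum_eq_core_add_sum_erase c x
  have h2 := sum_eq_core_add_sum_erase c (x ∘ Equiv.swap j k)
  have h3 : ∑ i, (x ∘ Equiv.swap j k) i = ∑ i, x i := Equiv.sum_comp (Equiv.swap j k) x
  have h4 : (x ∘ Equiv.swap j k) c = x c := by
    simp [Equiv.swap_apply_of_ne_of_ne hj.symm hk.symm]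
  rw [h3, h4, h1] at h2
  unfold othersAverage
  rw [add_left_cancel h2]

variable {M : Type u} [MeasurableSpace M]

/-- Under a noiseless signal that is invariant under permutations of the agents other than `c`,
these agents have the same posterior mean. -/
theorem integral_dispersion_eq_zero_of_invariant (hn : 2 ≤ n) (μ : ℝ) (s : ℝ≥0) (c : Fin n)
    {T : Profile n → M} (hT : Measurable T)
    (hinv : ∀ j k, j ≠ c → k ≠ c → ∀ x, T (x ∘ Equiv.swap j k) = T x) :
    ∫ p, dispersion c (posteriorMeans (prior n μ s) (Kernel.deterministic T hT) p.2)
      ∂(prior n μ s ⊗ₘ Kernel.deterministic T hT) = 0 := by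
  rw [integral_dispersion_eq_zero_iff (memLp_prior μ s)]
  have hn' : (2 : ℝ) ≤ n := by exact_mod_cast hn
  have hm : (n : ℝ) - 1 ≠ 0 := by linarith
  have h : ∀ᵐ p ∂(prior n μ s ⊗ₘ Kernel.deterministic T hT), ∀ j k, j ≠ c → k ≠ c →
      posteriorMeans (prior n μ s) (Kernel.deterministic T hT) p.2 k =
        posteriorMeans (prior n μ s) (Kernel.deterministic T hT) p.2 j := by
    simp only [ae_all_iff]
    intro j k hj hk
    -- Composing the `j`-th coordinate with the transposition of `j` and `k` gives the `k`-th.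
    have := posteriorMean_comp_eq hT
      (measurePreserving_permute_prior μ s (Equiv.swap j k)) (hinv j k hj hk)
      (measurable_pi_apply j) (memLp_prior μ s j)
    filter_upwards [this] with p hp
    simpa [posteriorMeans] using hp
  filter_upwards [h] with p hp j hj
  rw [othersAverage, Finset.sum_congr rfl fun k hk => hp j k hj (Finset.ne_of_mem_erase hk),
    sum_erase_const]
  field_simp

/-- A noiseless signal that discloses `x_c` and the average state of the others, and is
invariant under permutations of the others, induces no dispersion and no loss in the core
form. -/
theorem principalValue_of_coreAndAverage (hn : 2 ≤ n) {β : ℝ} (hβ : 0 ≤ β) (μ : ℝ) (s : ℝ≥0)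
    (c : Fin n) {T : Profile n → M} (hT : Measurable T) {g : M → ℝ × ℝ} (hg : Measurable g)
    (hgT : ∀ x, g (T x) = (x c, othersAverage c x))
    (hinv : ∀ j k, j ≠ c → k ≠ c → ∀ x, T (x ∘ Equiv.swap j k) = T x) :
    principalValue β (completeMatrix n) (prior n μ s) (Kernel.deterministic T hT)
        (fun m => starEquilibrium β c
          (posteriorMeans (prior n μ s) (Kernel.deterministic T hT) m)) =
      ∫ x, coreForm (coreLoss n β) c x ∂(prior n μ s) -
        ∫ x, ∑ i, x i ^ 2 ∂(prior n μ s) := by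
  have hP := memLp_prior (n := n) μ s
  have hc : Informs (prior n μ s) (Kernel.deterministic T hT) (fun x => x c) :=
    informs_of_factor hT hg.fst (measurable_pi_apply c) (hP c) fun x => by rw [hgT]
  have ha : Informs (prior n μ s) (Kernel.deterministic T hT) (othersAverage c) :=
    informs_of_factor hT hg.snd (measurable_othersAverage c)
      (memLp_othersAverage (w := fun x : Profile n => x) hP c) fun x => by rw [hgT]
  rw [principalValue_eq hP hn hβ c (isEquilibrium_starEquilibrium hP hn hβ c),
    integral_dispersion_eq_zero_of_invariant hn μ s c hT hinv,
    integral_coreForm_eq_add (φ := Kernel.deterministic T hT) hP hn (coreLoss n β) c,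
    (integral_coreForm_forecastError_eq_zero_iff hP hn hβ c).2 ⟨hc, ha⟩]
  ring

theorem principalValue_fullRevelation (hn : 2 ≤ n) {β : ℝ} (hβ : 0 ≤ β) (μ : ℝ) (s : ℝ≥0)
    (c : Fin n) :
    principalValue β (completeMatrix n) (prior n μ s) (fullRevelation n)
        (fun m => starEquilibrium β c (posteriorMeans (prior n μ s) (fullRevelation n) m)) =
      ∫ x, coreForm (coreLoss n β) c x ∂(prior n μ s) +
        dispersionValue n β * ∫ x, dispersion c x ∂(prior n μ s) -
          ∫ x, ∑ i, x i ^ 2 ∂(prior n μ s) := by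
  have hP := memLp_prior (n := n) μ s
  have h : ∀ᵐ p ∂(prior n μ s ⊗ₘ fullRevelation n),
      posteriorMeans (prior n μ s) (fullRevelation n) p.2 = p.1 := by
    have h' : ∀ i, Informs (prior n μ s) (fullRevelation n) (fun x => x i) := fun i =>
      informs_of_factor measurable_id (measurable_pi_apply i) (measurable_pi_apply i) (hP i)
        fun _ => rfl
    filter_upwards [ae_all_iff.2 h'] with p hp
    exact funext hp
  rw [principalValue_eq hP hn hβ c (isEquilibrium_starEquilibrium hP hn hβ c),
    ← integral_state_compProd (φ := fullRevelation n) (measurable_coreForm _ c),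
    ← integral_state_compProd (φ := fullRevelation n) (measurable_dispersion c)]
  congr 2
  · exact integral_congr_ae (by filter_upwards [h] with p hp; rw [hp])
  · congr 1
    exact integral_congr_ae (by filter_upwards [h] with p hp; rw [hp])

end Prior

end PublicSignal

/-! ### Optimal signals on either side of the threshold. -/

open PublicSignal

theorem proposition9 (n : ℕ) (hn : 2 ≤ n) (c : Fin n) (μ : ℝ) (s : ℝ≥0) (hs : 0 < s)
    (β : ℝ) (hβ : 0 ≤ β) :
    (1 / (2 * ((n : ℝ) - 1)) < β →
      PublicSignal.IsOptimal.{0, v} β (PublicSignal.starMatrix c) (PublicSignal.completeMatrix n)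
        (PublicSignal.prior n μ s) (PublicSignal.coreAndAverageSignal c) ∧
      ∀ (M : Type u) [MeasurableSpace M] (φ : Kernel (PublicSignal.Profile n) M)
        [IsMarkovKernel φ],
        PublicSignal.IsOptimal.{u, v} β (PublicSignal.starMatrix c)
          (PublicSignal.completeMatrix n) (PublicSignal.prior n μ s) φ →
        PublicSignal.Informs (PublicSignal.prior n μ s) φ (fun x => x c) ∧
        PublicSignal.Informs (PublicSignal.prior n μ s) φ (PublicSignal.othersAverage c) ∧
        ∀ j : Fin n, j ≠ c →
          ∀ᵐ p ∂((PublicSignal.prior n μ s) ⊗ₘ φ),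
            PublicSignal.posteriorMean (PublicSignal.prior n μ s) φ (fun x => x j) p.2 =
              PublicSignal.othersAverage c p.1) ∧
    (β ≤ 1 / (2 * ((n : ℝ) - 1)) →
      PublicSignal.IsOptimal.{0, v} β (PublicSignal.starMatrix c) (PublicSignal.completeMatrix n)
        (PublicSignal.prior n μ s) (PublicSignal.fullRevelation n)) := by
  have hn' : (2 : ℝ) ≤ n := by exact_mod_cast hn
  have hm : 0 < 2 * ((n : ℝ) - 1) := by linarith
  have hP := memLp_prior (n := n) μ s
  have hden : 0 < (1 + β) ^ 2 := by positivity
  constructor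
  · intro hlt
    -- The threshold on `β` is where 1 - 2β(n-1) changes sign.
    have hκ : dispersionValue n β < 0 := by
      rw [div_lt_iff₀ hm] at hlt
      exact div_neg_of_neg_of_pos (by linarith) hden
    refine ⟨⟨_, isEquilibrium_starEquilibrium hP hn hβ c, ?_⟩, ?_⟩
    · intro M' _ φ' _ a' ha'
      rw [principalValue_of_coreAndAverage hn hβ μ s c _ measurable_id (fun _ => rfl)
        fun j k hj hk x => Prod.ext
          (by simp [Equiv.swap_apply_of_ne_of_ne hj.symm hk.symm]) (othersAverage_swap hj hk x),
        principalValue_eq hP hn hβ c ha',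
        integral_coreForm_eq_add (φ := φ') hP hn (coreLoss n β) c]
      have h1 := integral_coreForm_forecastError_nonneg (P := prior n μ s) (φ := φ') hn hβ c
      have h2 : 0 ≤ ∫ p, dispersion c (posteriorMeans (prior n μ s) φ' p.2)
          ∂(prior n μ s ⊗ₘ φ') := integral_nonneg fun _ => dispersion_nonneg c _
      linarith [mul_nonpos_of_nonpos_of_nonneg hκ.le h2]
    · rintro M _ φ _ ⟨a, ha, hopt⟩
      -- The rivals in the optimality of `φ` have realizations in `Type v`, so the candidate signal
      -- is lifted to that universe before it is compared with `φ`.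
      have hT : Measurable fun x : Profile n => ULift.up.{v} (x c, othersAverage c x) :=
        measurable_up.comp ((measurable_pi_apply c).prodMk (measurable_othersAverage c))
      have hle := hopt _ (Kernel.deterministic _ hT) _
        (isEquilibrium_starEquilibrium hP hn hβ c)
      rw [principalValue_of_coreAndAverage hn hβ μ s c hT measurable_down (fun _ => rfl)
        fun j k hj hk x => congrArg ULift.up (Prod.ext
          (by simp [Equiv.swap_apply_of_ne_of_ne hj.symm hk.symm]) (othersAverage_swap hj hk x)),
        principalValue_eq hP hn hβ c ha,
        integral_coreForm_eq_add (φ := φ) hP hn (coreLoss n β) c] at hle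
      have h1 := integral_coreForm_forecastError_nonneg (P := prior n μ s) (φ := φ) hn hβ c
      have h2 : 0 ≤ ∫ p, dispersion c (posteriorMeans (prior n μ s) φ p.2)
          ∂(prior n μ s ⊗ₘ φ) := integral_nonneg fun _ => dispersion_nonneg c _
      have h3 := mul_nonpos_of_nonpos_of_nonneg hκ.le h2
      -- Optimality bounds the core-form loss by κ times the expected dispersion. The former is
      -- nonnegative and the latter nonpositive, so both vanish; κ ≠ 0 then removes the dispersion.
      obtain ⟨hcore, havg⟩ := (integral_coreForm_forecastError_eq_zero_iff hP hn hβ c).1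
        (le_antisymm (by linarith) h1)
      have h4 : dispersionValue n β * ∫ p, dispersion c (posteriorMeans (prior n μ s) φ p.2)
          ∂(prior n μ s ⊗ₘ φ) = 0 := by linarith
      have hdisp := (integral_dispersion_eq_zero_iff hP c).1
        ((mul_eq_zero.1 h4).resolve_left hκ.ne)
      refine ⟨hcore, havg, fun j hj => ?_⟩
      filter_upwards [hdisp, havg, measurePreserving_snd_compProd.quasiMeasurePreserving.ae
        (posteriorMean_othersAverage (φ := φ) hP c)] with p hp1 hp2 hp3
      rw [← hp2, hp3]
      exact hp1 j hj
  · intro hle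
    have hκ : 0 ≤ dispersionValue n β := by
      rw [le_div_iff₀ hm] at hle
      exact div_nonneg (by linarith) hden.le
    refine ⟨_, isEquilibrium_starEquilibrium hP hn hβ c, ?_⟩
    intro M' _ φ' _ a' ha'
    -- Both quadratic terms now favor information: the shortfall of any rival is its core-form loss
    -- plus κ times the dispersion of its forecast errors.
    rw [principalValue_fullRevelation hn hβ μ s c, principalValue_eq hP hn hβ c ha',
      integral_coreForm_eq_add (φ := φ') hP hn (coreLoss n β) c,
      integral_dispersion_eq_add (φ := φ') hP hn c]
    have h1 := integral_coreForm_forecastError_nonneg (P := prior n μ s) (φ := φ') hn hβ c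
    have h2 : 0 ≤ ∫ p, dispersion c (p.1 - posteriorMeans (prior n μ s) φ' p.2)
        ∂(prior n μ s ⊗ₘ φ') := integral_nonneg fun _ => dispersion_nonneg c _
    have h3 := mul_nonneg hκ h2
    linarith
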